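/- For a permutation $\sigma$ of $[m]=\{1,\dots,m\}$ let $\mathrm{exc}(\sigma)$ be the number of $i$ with $\sigma(i)>i$, $\mathrm{fix}(\sigma)$ the number of fixed points, and $\mathrm{cyc}(\sigma)$ the number of cycles, fixed points included. Write $\sigma$ in standard cycle form: each cycle $(c_1,\dots,c_r)$, meaning $\sigma(c_j)=c_{j+1}$ for $j<r$ and $\sigma(c_r)=c_1$, is written with its largest element last, and the cycles are listed in decreasing order of their largest elements; let $\mathrm{fcyc}(\sigma)$ be the number of elements of the first cycle, i.e. of the cycle containing $m$. For $m\ge 1$ let $\widehat{\mathcal Q}_m$ be the set of permutations $\sigma$ of $[m]$ for which the sequence of entries of the cycle containing $m$, written in this form, is increasing. For $n\ge 0$ put $$\widetilde A_n(x,y,q,p)=\sum_{\sigma\in\widehat{\mathcal Q}_{n+1}}x^{\mathrm{exc}(\sigma)}y^{\mathrm{fix}(\sigma)}q^{\mathrm{cyc}(\sigma)}p^{\mathrm{fcyc}(\sigma)}.$$ Then for every $n\ge 0$ the following identities hold, as polynomial identities in $x$ (equivalently, for $x$ in any commutative ring): $$\widetilde A_n(x,1,-1,-1)=\sum_{\sigma\in\widehat{\mathcal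 Q}_{n+1}}x^{\mathrm{exc}(\sigma)}(-1)^{\mathrm{cyc}(\sigma)+\mathrm{fcyc}(\sigma)}=(-1)^n(1+x+x^2+\cdots+x^n),$$ $$\widetilde A_n(x,1,-1,1)=\sum_{\sigma\in\widehat{\mathcal Q}_{n+1}}x^{\mathrm{exc}(\sigma)}(-1)^{\mathrm{cyc}(\sigma)}=\sum_{k=0}^n x^{n-k}\sum_{i=k}^n(-1)^{i-1}2^{n-i}\binom ni.$$ -/

import Mathlib

namespace BinomialEulerian

/-- The number of excedances: indices `i` with `σ i > i`. -/
def exc {n : ℕ} (σ : Equiv.Perm (Fin n)) : ℕ :=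
  (Finset.univ.filter fun i => i < σ i).card

/-- The number of fixed points. -/
def fix {n : ℕ} (σ : Equiv.Perm (Fin n)) : ℕ :=
  (Finset.univ.filter fun i => σ i = i).card

/-- The number of cycles, fixed points included as cycles of length one
(`cycleType` lists the lengths of the nontrivial cycles only). -/
def cyc {n : ℕ} (σ : Equiv.Perm (Fin n)) : ℕ :=
  Multiset.card σ.cycleType + fix σ

/-- The first cycle in standard cycle form, for permutations of the `n + 1` element chain
`Fin (n + 1)`: each cycle is written with its largest element last and the cycles are ordered by
decreasing largest element, so the first cycle is the one of the largest element `m`,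
written as `(σ m, σ² m, …, σᶜ m = m)`, where `c` is its length. -/
noncomputable def firstCycle {n : ℕ} (σ : Equiv.Perm (Fin (n + 1))) : List (Fin (n + 1)) :=
  (List.range (Function.minimalPeriod σ (Fin.last n))).map fun j => (σ ^ (j + 1)) (Fin.last n)

/-- The number of elements of the first cycle. -/
noncomputable def fcyc {n : ℕ} (σ : Equiv.Perm (Fin (n + 1))) : ℕ :=
  (firstCycle σ).length

open Classical in
/-- The permutations of an `n + 1` element chain such that the sequence in the cycle of the
largest element (in standard form) is increasing. `QHat n` is the set usually indexed
by `n + 1`. -/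
noncomputable def QHat (n : ℕ) : Finset (Equiv.Perm (Fin (n + 1))) :=
  Finset.univ.filter fun σ => (firstCycle σ).Pairwise (· < ·)

/-- The multivariable binomial-Eulerian polynomial, at elements of a commutative ring. -/
noncomputable def ATilde {R : Type*} [CommRing R] (n : ℕ) (x y q p : R) : R :=
  ∑ σ ∈ QHat n, x ^ exc σ * y ^ fix σ * q ^ cyc σ * p ^ fcyc σ

end BinomialEulerian

/-!
The factor `(-1) ^ cyc σ` is `(-1) ^ (n + 1)` times the sign of `σ` (`neg_one_pow_cyc`), and
`x ^ exc σ` is a product of entries of a matrix with `x` below the diagonal and `1` elsewhere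
(`prod_excMatrix`), so sums of the weight over permutations are pieces of Leibniz expansions.

A permutation in `QHat n` is determined by the set `S` of elements, other than the largest, of its
first cycle, together with an arbitrary permutation of the complement of that cycle
(`mem_QHat_and_iff`). The increasing cycle contributes the sign `(-1) ^ |S|` and the weight
`x ^ |S|`; the complement contributes a determinant of the same shape, of size `n - |S|`, which is
`(1 - x) ^ (n - |S| - 1)` for nonempty complement and `1` otherwise (`det_excMatrix`). Grouping the
sets `S` by cardinality (`sum_QHat_eq`), the sum with `p ^ fcyc σ` equals
`(-1) ^ (n + 1) * p * ∑ k, n.choose k * (-p * x) ^ k * (1 - x) ^ (n - k - 1)`.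

Multiplying by `1 - x` and applying the binomial theorem gives closed forms for `p = -1` and
`p = 1` that agree with `1 - x` times the right-hand sides of the identities. Since `1 - x` need not
be cancellable in `R`, the cancellation is done for the indeterminate of `ℤ[X]`, and the resulting
identity is then evaluated at `x`.
-/

namespace BinomialEulerian

open Equiv Finset

/-! ### Weights as signed products of matrix entries -/

/-- The matrix whose `(a, b)` entry is `x` when `b < a` and `1` otherwise, so that
`∏ i, excMatrix x (σ i) i` is `x` to the number of excedances of `σ`. -/
def excMatrix {ι R : Type*} [LinearOrder ι] [CommRing R] (x : R) : Matrix ι ι R :=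
  Matrix.of fun a b => if b < a then x else 1

theorem prod_excMatrix {R : Type*} [CommRing R] {n : ℕ} (x : R) (σ : Perm (Fin n)) :
    ∏ i, excMatrix x (σ i) i = x ^ exc σ := by
  simp [excMatrix, exc, Finset.prod_ite]

/-- The sign of `σ` is `(-1) ^ (n - cyc σ)`. -/
theorem neg_one_pow_cyc {R : Type*} [CommRing R] {n : ℕ} (σ : Perm (Fin n)) :
    (-1 : R) ^ cyc σ = (-1) ^ n * (((Perm.sign σ : ℤˣ) : ℤ) : R) := by
  have h : σ.support.card + fix σ = n := by
    have := Finset.card_filter_add_card_filter_not (s := (univ : Finset (Fin n)))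
      (fun i => σ i = i)
    rw [Finset.card_univ, Fintype.card_fin] at this
    rw [add_comm]
    exact this
  rw [Perm.sign_of_cycleType, Perm.sum_cycleType, cyc]
  push_cast
  rw [← pow_add, show n + (σ.support.card + Multiset.card σ.cycleType) =
    (Multiset.card σ.cycleType + fix σ) + 2 * σ.support.card by omega, pow_add _ _ (2 * _),
    pow_mul]
  simp

/-- The exponent is a truncated subtraction, with value `0` for the empty matrix. Subtracting from
each row its predecessor leaves an upper triangular matrix with diagonal `1, 1 - x, …, 1 - x`. -/
theorem det_excMatrix_transpose_fin {R : Type*} [CommRing R] (x : R) (m : ℕ) :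
    (excMatrix x : Matrix (Fin m) (Fin m) R).transpose.det = (1 - x) ^ (m - 1) := by
  cases m with
  | zero => simp
  | succ m =>
    let B : Matrix (Fin (m + 1)) (Fin (m + 1)) R := Matrix.of fun i j =>
      if i = 0 then (if j = 0 then 1 else x) else if i = j then 1 - x else 0
    have hB : B.IsUpperTriangular := by
      intro i j hij
      have hij : j < i := hij
      have h0 : i ≠ 0 := by
        rintro rfl
        simp at hij
      simp [B, h0, hij.ne']
    rw [Matrix.det_eq_of_forall_row_eq_smul_add_pred (B := B) (fun _ => 1),
      Matrix.det_of_isUpperTriangular hB, Fin.prod_univ_succ]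
    · simp [B]
    · intro j
      simp [B, excMatrix, Fin.pos_iff_ne_zero, ite_not]
    · intro i j
      simp only [Matrix.transpose_apply, excMatrix, Matrix.of_apply, B, Fin.succ_ne_zero, if_false,
        one_mul]
      simp only [Fin.lt_def, Fin.ext_iff, Fin.val_succ, Fin.val_castSucc]
      split_ifs <;> first | omega | simp

/-- The exponent is a truncated subtraction: the empty determinant is `1 = (1 - x) ^ (0 - 1)`.
Decidability of equality is a separate instance argument so that the lemma applies whichever
instance the determinant carries. -/
theorem det_excMatrix {ι R : Type*} [Fintype ι] [LinearOrder ι] [DecidableEq ι] [CommRing R]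
    (x : R) :
    (excMatrix x : Matrix ι ι R).det = (1 - x) ^ (Fintype.card ι - 1) := by
  let e := Fintype.orderIsoFinOfCardEq ι rfl
  rw [← Matrix.det_submatrix_equiv_self e.toEquiv, ← det_excMatrix_transpose_fin,
    Matrix.det_transpose]
  congr 1
  ext a b
  simp [excMatrix]

/-- The part of the Leibniz expansion of `det M` over the permutations that agree on `T` with a
given permutation `c` supported in `T`: they are `c * τ`, where `τ` permutes the complement. -/
theorem sum_sign_mul_prod_of_eqOn {α R : Type*} [Fintype α] [DecidableEq α] [CommRing R]
    (M : Matrix α α R) (T : Finset α) (c : Perm α) (hc : ∀ a ∉ T, c a = a)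
    [DecidablePred fun σ : Perm α => ∀ a ∈ T, σ a = c a] :
    ∑ σ : Perm α with ∀ a ∈ T, σ a = c a, (((Perm.sign σ : ℤˣ) : ℤ) : R) * ∏ i, M (σ i) i =
      (((Perm.sign c : ℤˣ) : ℤ) : R) * (∏ i ∈ T, M (c i) i) *
        (M.submatrix Subtype.val Subtype.val : Matrix {a // a ∉ T} {a // a ∉ T} R).det := by
  rw [Matrix.det_apply', Finset.mul_sum]
  symm
  refine Finset.sum_bij (fun τ _ => c * Perm.ofSubtype τ) ?_ ?_ ?_ ?_
  · intro τ _
    simp only [mem_filter, mem_univ, true_and]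
    intro a ha
    rw [Perm.mul_apply, Perm.ofSubtype_apply_of_not_mem τ (not_not.mpr ha)]
  · intro τ _ τ' _ h
    exact Perm.ofSubtype_injective (mul_left_cancel h)
  · -- `c⁻¹ * σ` fixes `T` pointwise, so it comes from a permutation of the complement.
    intro σ hσ
    simp only [mem_filter, mem_univ, true_and] at hσ
    have hfix : ∀ a, (c⁻¹ * σ) a ≠ a → a ∉ T := by
      intro a h ha
      apply h
      rw [Perm.mul_apply, hσ a ha, ← Perm.mul_apply, inv_mul_cancel, Perm.one_apply]
    have hmem : ∀ a, (c⁻¹ * σ) a ∉ T ↔ a ∉ T := by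
      intro a
      by_cases h : (c⁻¹ * σ) a = a
      · rw [h]
      · exact iff_of_true (hfix _ fun h' => h ((c⁻¹ * σ).injective h')) (hfix a h)
    refine ⟨(c⁻¹ * σ).subtypePerm hmem, mem_univ _, ?_⟩
    rw [Perm.ofSubtype_subtypePerm hmem hfix, mul_inv_cancel_left]
  · intro τ _
    have hT : ∏ i ∈ T, M ((c * Perm.ofSubtype τ) i) i = ∏ i ∈ T, M (c i) i := by
      refine Finset.prod_congr rfl fun i hi => ?_
      rw [Perm.mul_apply, Perm.ofSubtype_apply_of_not_mem τ (not_not.mpr hi)]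
    have hTc : ∏ i ∈ Tᶜ, M ((c * Perm.ofSubtype τ) i) i =
        ∏ i : {a // a ∉ T}, M (τ i : α) (i : α) := by
      rw [Finset.prod_subtype (p := fun a => a ∉ T) Tᶜ (by simp)]
      refine Finset.prod_congr rfl fun i _ => ?_
      rw [Perm.mul_apply, Perm.ofSubtype_apply_coe, hc _ (τ i).2]
    rw [← Finset.prod_mul_prod_compl T, hT, hTc, Perm.sign_mul, Perm.sign_ofSubtype]
    simp only [Units.val_mul, Int.cast_mul, Matrix.submatrix_apply]
    ring

/-! ### The first cycle -/

/-- A list without repetitions that ends in the largest element is the first cycle of `σ` exactly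
when `σ` permutes its entries cyclically. -/
theorem firstCycle_eq_iff {n : ℕ} (σ : Perm (Fin (n + 1))) (l : List (Fin (n + 1)))
    (hl : (l ++ [Fin.last n]).Nodup) :
    firstCycle σ = l ++ [Fin.last n] ↔
      ∀ a ∈ l ++ [Fin.last n], σ a = (l ++ [Fin.last n]).formPerm a := by
  set L := l ++ [Fin.last n] with hL
  have hlen : L.length = l.length + 1 := by simp [hL]
  have hlast : ∀ h : l.length < L.length, L[l.length] = Fin.last n := by simp [hL]
  constructor
  · intro h a ha
    obtain ⟨j, hj, rfl⟩ := List.getElem_of_mem ha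
    have hlen' : Function.minimalPeriod σ (Fin.last n) = L.length := by
      rw [← h]
      simp [firstCycle]
    have key : ∀ (i : ℕ) (hi : i < L.length), L[i] = (σ ^ (i + 1)) (Fin.last n) := by
      intro i hi
      simp [← h, firstCycle]
    rw [List.formPerm_apply_getElem L hl, key j hj, key, ← Perm.mul_apply, ← pow_succ']
    rcases Nat.lt_or_ge (j + 1) L.length with h1 | h1
    · rw [Nat.mod_eq_of_lt h1]
    · have h2 : j + 1 = L.length := by omega
      rw [h2, Nat.mod_self, pow_succ, Perm.mul_apply, zero_add, pow_one, ← hlen',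
        ← Perm.mul_apply, ← pow_succ, pow_succ', Perm.mul_apply, Perm.coe_pow,
        Function.iterate_minimalPeriod]
  · intro h
    -- Starting from the last entry, the iterates of `σ` run through the list from its beginning.
    have key : ∀ (i : ℕ) (hi : i < L.length), (σ ^ (i + 1)) (Fin.last n) = L[i] := by
      intro i
      induction i with
      | zero =>
        intro hi
        rw [zero_add, pow_one, h _ (by simp [hL])]
        conv_lhs => rw [← hlast (by omega)]
        rw [List.formPerm_apply_getElem L hl]
        congr 1
        rw [← hlen, Nat.mod_self]
      | succ i ih =>
        intro hi
        rw [pow_succ', Perm.mul_apply, ih (by omega), h _ (List.getElem_mem _),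
          List.formPerm_apply_getElem L hl]
        congr 1
        exact Nat.mod_eq_of_lt hi
    have hper : Function.IsPeriodicPt σ L.length (Fin.last n) := by
      rw [Function.IsPeriodicPt, Function.IsFixedPt, ← Perm.coe_pow, hlen, key _ (by omega),
        hlast]
    have hmin : Function.minimalPeriod σ (Fin.last n) = L.length := by
      refine le_antisymm (hper.minimalPeriod_le (by omega)) ?_
      have hpos := hper.minimalPeriod_pos (by omega)
      have h1 := Function.iterate_minimalPeriod (f := σ) (x := Fin.last n)
      -- An earlier return to the last entry would be a repetition in the list.
      by_contra! hlt
      obtain ⟨k, hk⟩ := Nat.exists_eq_add_of_lt hpos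
      rw [zero_add] at hk
      rw [hk, ← Perm.coe_pow, key k (by omega), ← hlast (by omega), hl.getElem_inj_iff] at h1
      omega
    refine List.ext_getElem (by simp [firstCycle, hmin]) fun i h1 h2 => ?_
    rw [← key i h2]
    simp [firstCycle]

theorem exists_firstCycle_eq_append_last {n : ℕ} (σ : Perm (Fin (n + 1))) :
    ∃ l, firstCycle σ = l ++ [Fin.last n] := by
  have hpos : 0 < Function.minimalPeriod σ (Fin.last n) :=
    Function.minimalPeriod_pos_of_mem_periodicPts
      (σ.injective.mem_periodicPts _)
  obtain ⟨k, hk⟩ := Nat.exists_eq_add_of_lt hpos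
  rw [zero_add] at hk
  have h1 := Function.iterate_minimalPeriod (f := σ) (x := Fin.last n)
  rw [hk, ← Perm.coe_pow] at h1
  refine ⟨(List.range k).map fun j => (σ ^ (j + 1)) (Fin.last n), ?_⟩
  rw [firstCycle, hk, List.range_succ, List.map_append, List.map_singleton, h1]

/-- The elements of `S` in increasing order, followed by the largest element. -/
def increasingList {n : ℕ} (S : Finset (Fin (n + 1))) : List (Fin (n + 1)) :=
  S.sort (· ≤ ·) ++ [Fin.last n]

theorem pairwise_increasingList {n : ℕ} {S : Finset (Fin (n + 1))} (hS : Fin.last n ∉ S) :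
    (increasingList S).Pairwise (· < ·) := by
  rw [increasingList, List.pairwise_append]
  refine ⟨(Finset.sortedLT_sort S).pairwise, List.pairwise_singleton _ _, ?_⟩
  intro a ha b hb
  rw [List.mem_singleton] at hb
  rw [Finset.mem_sort] at ha
  subst hb
  exact lt_of_le_of_ne (Fin.le_last a) fun h => hS (h ▸ ha)

theorem mem_increasingList {n : ℕ} {S : Finset (Fin (n + 1))} {a : Fin (n + 1)} :
    a ∈ increasingList S ↔ a ∈ insert (Fin.last n) S := by
  simp [increasingList, or_comm]

theorem length_increasingList {n : ℕ} (S : Finset (Fin (n + 1))) :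
    (increasingList S).length = S.card + 1 := by
  simp [increasingList]

theorem sign_formPerm_increasingList {n : ℕ} {S : Finset (Fin (n + 1))} (hS : Fin.last n ∉ S) :
    Perm.sign (increasingList S).formPerm = (-1) ^ S.card := by
  have hnd : (increasingList S).Nodup := (pairwise_increasingList hS).imp fun h => h.ne
  rcases Nat.eq_zero_or_pos S.card with h0 | h0
  · rw [Finset.card_eq_zero] at h0
    subst h0
    simp [increasingList]
  -- `List.formPerm` is a cycle with the expected support only for lists of at least two entries.
  · have hlen := length_increasingList S
    rw [(List.isCycle_formPerm hnd (by omega)).sign, List.support_formPerm_of_nodup _ hnd,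
      List.toFinset_card_of_nodup hnd, hlen, pow_succ]
    · simp
    · intro a h
      rw [h, List.length_singleton] at hlen
      omega

/-- On an increasing cycle every element but the largest is an excedance. -/
theorem prod_excMatrix_increasingList {n : ℕ} {R : Type*} [CommRing R] (x : R)
    {S : Finset (Fin (n + 1))} (hS : Fin.last n ∉ S) :
    ∏ i ∈ insert (Fin.last n) S, excMatrix x ((increasingList S).formPerm i) i = x ^ S.card := by
  have hp := pairwise_increasingList hS
  have hnd : (increasingList S).Nodup := hp.imp fun h => h.ne
  have hlen := length_increasingList S
  have hlt : ∀ i ∈ S, i < (increasingList S).formPerm i := by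
    intro i hi
    obtain ⟨j, hj, rfl⟩ := List.getElem_of_mem (mem_increasingList.mpr (mem_insert_of_mem hi))
    have hj' : j + 1 < (increasingList S).length := by
      by_contra! h
      have hjS : j = S.card := by omega
      subst hjS
      apply hS
      simpa [increasingList] using hi
    rw [List.formPerm_apply_getElem _ hnd]
    simp only [Nat.mod_eq_of_lt hj']
    exact List.pairwise_iff_getElem.mp hp _ _ _ _ (Nat.lt_succ_self j)
  rw [Finset.prod_insert hS, Finset.prod_congr rfl (g := fun _ => x), Finset.prod_const]
  · simp [excMatrix, (Fin.le_last _).not_gt]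
  · intro i hi
    simp [excMatrix, hlt i hi]

/-- The permutations in `QHat n` whose first cycle consists of `S` and the largest element are
those that agree on these elements with the increasing cycle; elsewhere they are arbitrary. -/
theorem mem_QHat_and_iff {n : ℕ} {S : Finset (Fin (n + 1))} (hS : Fin.last n ∉ S)
    (σ : Perm (Fin (n + 1))) :
    σ ∈ QHat n ∧ (firstCycle σ).toFinset.erase (Fin.last n) = S ↔
      ∀ a ∈ insert (Fin.last n) S, σ a = (increasingList S).formPerm a := by
  have hp := pairwise_increasingList hS
  have hnd : (increasingList S).Nodup := hp.imp fun h => h.ne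
  have h1 := firstCycle_eq_iff σ (S.sort (· ≤ ·)) hnd
  change firstCycle σ = increasingList S ↔ ∀ a ∈ increasingList S, σ a = _ at h1
  simp only [mem_increasingList] at h1
  refine Iff.trans ?_ h1
  rw [QHat, mem_filter, and_iff_right (mem_univ σ)]
  constructor
  · rintro ⟨h2, rfl⟩
    refine h2.eq_of_mem_iff hp fun a => ?_
    obtain ⟨l, hl⟩ := exists_firstCycle_eq_append_last σ
    rw [mem_increasingList, Finset.insert_erase (by simp [hl]), List.mem_toFinset]
  · intro h
    refine ⟨h ▸ hp, ?_⟩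
    rw [h]
    ext a
    rw [mem_erase, List.mem_toFinset, mem_increasingList, mem_insert]
    constructor
    · tauto
    · intro ha
      exact ⟨fun h => hS (h ▸ ha), Or.inr ha⟩

theorem fcyc_eq {n : ℕ} {S : Finset (Fin (n + 1))} (hS : Fin.last n ∉ S) {σ : Perm (Fin (n + 1))}
    (hσ : ∀ a ∈ insert (Fin.last n) S, σ a = (increasingList S).formPerm a) :
    fcyc σ = S.card + 1 := by
  have hnd : (increasingList S).Nodup := (pairwise_increasingList hS).imp fun h => h.ne
  rw [fcyc, ← length_increasingList]
  congr 1
  refine (firstCycle_eq_iff σ (S.sort (· ≤ ·)) hnd).mpr fun a ha => ?_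
  exact hσ a (mem_increasingList.mp ha)

/-! ### Summation over the first cycle -/

/-- Each set `S` of elements joining the largest one in the first cycle contributes a term that
depends only on its cardinality `k`. -/
theorem sum_QHat_eq {R : Type*} [CommRing R] (n : ℕ) (x p : R) :
    ∑ σ ∈ QHat n, x ^ exc σ * (-1) ^ cyc σ * p ^ fcyc σ =
      (-1) ^ (n + 1) * p *
        ∑ k ∈ range (n + 1), (n.choose k : R) * (-(p * x)) ^ k * (1 - x) ^ (n - k - 1) := by
  have hfib : ∀ σ ∈ QHat n, (firstCycle σ).toFinset.erase (Fin.last n) ∈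
      (univ.erase (Fin.last n)).powerset := fun σ _ =>
    mem_powerset.mpr (erase_subset_erase _ (subset_univ _))
  have hS : ∀ S ∈ (univ.erase (Fin.last n)).powerset,
      ∑ σ ∈ QHat n with (firstCycle σ).toFinset.erase (Fin.last n) = S,
        x ^ exc σ * (-1) ^ cyc σ * p ^ fcyc σ =
      (-1) ^ (n + 1) * p * ((-(p * x)) ^ S.card * (1 - x) ^ (n - S.card - 1)) := by
    intro S hS
    have hlast : Fin.last n ∉ S := fun h => by simpa using mem_powerset.mp hS h
    have hfilter : (QHat n).filter (fun σ => (firstCycle σ).toFinset.erase (Fin.last n) = S) =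
        univ.filter fun σ => ∀ a ∈ insert (Fin.last n) S,
          σ a = (increasingList S).formPerm a := by
      ext σ
      rw [mem_filter, mem_QHat_and_iff hlast, mem_filter, and_iff_right (mem_univ σ)]
    have hcard : Fintype.card {a // a ∉ insert (Fin.last n) S} = n - S.card := by
      rw [Fintype.card_subtype_compl, Fintype.card_fin, Fintype.card_coe,
        Finset.card_insert_of_notMem hlast]
      omega
    have hterm : ∀ σ ∈ univ.filter (fun σ : Perm (Fin (n + 1)) =>
          ∀ a ∈ insert (Fin.last n) S, σ a = (increasingList S).formPerm a),
        x ^ exc σ * (-1) ^ cyc σ * p ^ fcyc σ =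
          (-1) ^ (n + 1) * p ^ (S.card + 1) *
            ((((Perm.sign σ : ℤˣ) : ℤ) : R) * ∏ i, excMatrix x (σ i) i) := by
      intro σ hσ
      rw [fcyc_eq hlast (mem_filter.mp hσ).2, neg_one_pow_cyc, prod_excMatrix]
      ring
    have hsum := sum_sign_mul_prod_of_eqOn (excMatrix x) (insert (Fin.last n) S)
      (increasingList S).formPerm
      fun a ha => List.formPerm_apply_of_notMem (mt mem_increasingList.mp ha)
    rw [hfilter, Finset.sum_congr rfl hterm, ← Finset.mul_sum, hsum,
      sign_formPerm_increasingList hlast, prod_excMatrix_increasingList x hlast]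
    have hdet := det_excMatrix (ι := {a // a ∉ insert (Fin.last n) S}) x
    rw [hcard] at hdet
    have hsub : ((excMatrix x : Matrix (Fin (n + 1)) (Fin (n + 1)) R).submatrix Subtype.val
        Subtype.val : Matrix {a // a ∉ insert (Fin.last n) S} {a // a ∉ insert (Fin.last n) S} R) =
        excMatrix x := rfl
    rw [hsub, hdet]
    push_cast
    rw [neg_pow (p * x), mul_pow]
    ring
  rw [← Finset.sum_fiberwise_of_maps_to hfib, Finset.sum_congr rfl hS, ← Finset.mul_sum,
    Finset.sum_powerset_apply_card fun k => (-(p * x)) ^ k * (1 - x) ^ (n - k - 1)]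
  simp [nsmul_eq_mul, mul_assoc]

/-! ### Evaluation of the binomial sums -/

/-- The last term `k = n` has the truncated exponent `0` in place of `-1`, which accounts for the
correction to the binomial theorem. -/
theorem one_sub_mul_sum_choose {R : Type*} [CommRing R] (n : ℕ) (a x : R) :
    (1 - x) * ∑ k ∈ range (n + 1), (n.choose k : R) * a ^ k * (1 - x) ^ (n - k - 1) =
      (a + (1 - x)) ^ n - x * a ^ n := by
  have h : ∀ k ∈ range n, (1 - x) * ((n.choose k : R) * a ^ k * (1 - x) ^ (n - k - 1)) =
      a ^ k * (1 - x) ^ (n - k) * (n.choose k : R) := by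
    intro k hk
    rw [mem_range] at hk
    obtain ⟨m, hm⟩ : ∃ m, n - k = m + 1 := ⟨n - k - 1, by omega⟩
    rw [hm, Nat.add_sub_cancel, pow_succ]
    ring
  rw [add_pow, sum_range_succ, sum_range_succ, mul_add, Finset.mul_sum, Finset.sum_congr rfl h]
  simp
  ring

theorem one_sub_X_cancel {f g : Polynomial ℤ}
    (h : (1 - Polynomial.X) * f = (1 - Polynomial.X) * g) : f = g := by
  refine mul_left_cancel₀ ?_ h
  rw [← neg_sub, neg_ne_zero]
  simpa using Polynomial.X_sub_C_ne_zero (1 : ℤ)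

theorem sum_choose_mul_pow_eq_geom_sum {R : Type*} [CommRing R] (n : ℕ) (x : R) :
    ∑ k ∈ range (n + 1), (n.choose k : R) * x ^ k * (1 - x) ^ (n - k - 1) =
      ∑ j ∈ range (n + 1), x ^ j := by
  have key : ∑ k ∈ range (n + 1), (n.choose k : Polynomial ℤ) * Polynomial.X ^ k *
      (1 - Polynomial.X) ^ (n - k - 1) = ∑ j ∈ range (n + 1), Polynomial.X ^ j := by
    apply one_sub_X_cancel
    rw [one_sub_mul_sum_choose, mul_neg_geom_sum]
    ring
  simpa using congrArg (Polynomial.aeval x) key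

/-- After exchanging the sums, the inner sum over `k ≤ i` is geometric, and the outer sum is a
binomial expansion of `(2 * x - 1) ^ n` and of `(2 - 1) ^ n`. -/
theorem sum_mul_sum_Icc_eq {R : Type*} [CommRing R] (n : ℕ) (x : R) :
    (1 - x) * ∑ k ∈ range (n + 1), x ^ (n - k) *
        ∑ i ∈ Icc k n, (-1) ^ (i + 1) * 2 ^ (n - i) * (n.choose i : R) =
      x ^ (n + 1) - (2 * x - 1) ^ n := by
  have hswap : ∑ k ∈ range (n + 1), x ^ (n - k) *
        ∑ i ∈ Icc k n, (-1) ^ (i + 1) * 2 ^ (n - i) * (n.choose i : R) =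
      ∑ i ∈ range (n + 1), ((-1) ^ (i + 1) * 2 ^ (n - i) * (n.choose i : R)) *
        ∑ k ∈ range (i + 1), x ^ (n - k) := by
    simp_rw [Finset.mul_sum]
    rw [Finset.sum_comm' (t' := range (n + 1)) (s' := fun i => range (i + 1))]
    · exact Finset.sum_congr rfl fun i _ => Finset.sum_congr rfl fun k _ => mul_comm _ _
    · intro k i
      simp only [mem_range, mem_Icc]
      omega
  have hgeom : ∀ i ≤ n, (1 - x) * ∑ k ∈ range (i + 1), x ^ (n - k) =
      x ^ (n - i) - x ^ (n + 1) := by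
    intro i
    induction i with
    | zero =>
      intro _
      simp
      ring
    | succ i ih =>
      intro hi
      rw [sum_range_succ, mul_add, ih (by omega), show n - i = n - (i + 1) + 1 by omega]
      ring
  have h1 : ∑ i ∈ range (n + 1), (-1 : R) ^ i * 2 ^ (n - i) * (n.choose i : R) = 1 := by
    rw [← add_pow]
    norm_num
  have h2 : ∑ i ∈ range (n + 1), (-1 : R) ^ i * (2 * x) ^ (n - i) * (n.choose i : R) =
      (2 * x - 1) ^ n := by
    rw [← add_pow]
    ring
  have h3 : x ^ (n + 1) =
      ∑ i ∈ range (n + 1), x ^ (n + 1) * ((-1 : R) ^ i * 2 ^ (n - i) * (n.choose i : R)) := by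
    rw [← Finset.mul_sum, h1, mul_one]
  rw [hswap, Finset.mul_sum, ← h2, h3, ← Finset.sum_sub_distrib]
  refine Finset.sum_congr rfl fun i hi => ?_
  rw [mul_left_comm, hgeom i (by simpa [Nat.lt_succ_iff] using hi), mul_pow]
  ring

theorem sum_choose_mul_neg_pow_eq {R : Type*} [CommRing R] (n : ℕ) (x : R) :
    (-1) ^ (n + 1) * ∑ k ∈ range (n + 1), (n.choose k : R) * (-x) ^ k * (1 - x) ^ (n - k - 1) =
      ∑ k ∈ range (n + 1), x ^ (n - k) *
        ∑ i ∈ Icc k n, (-1) ^ (i + 1) * 2 ^ (n - i) * (n.choose i : R) := by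
  have key : (-1) ^ (n + 1) * ∑ k ∈ range (n + 1), (n.choose k : Polynomial ℤ) *
        (-Polynomial.X) ^ k * (1 - Polynomial.X) ^ (n - k - 1) =
      ∑ k ∈ range (n + 1), Polynomial.X ^ (n - k) *
        ∑ i ∈ Icc k n, (-1) ^ (i + 1) * 2 ^ (n - i) * (n.choose i : Polynomial ℤ) := by
    apply one_sub_X_cancel
    rw [mul_left_comm, one_sub_mul_sum_choose, sum_mul_sum_Icc_eq,
      show -Polynomial.X + (1 - Polynomial.X) = -(2 * Polynomial.X - 1 : Polynomial ℤ) by ring,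
      neg_pow (2 * Polynomial.X - 1 : Polynomial ℤ), neg_pow (Polynomial.X : Polynomial ℤ)]
    have h : ((-1 : Polynomial ℤ) ^ n) * (-1) ^ n = 1 := by
      rw [← mul_pow]
      norm_num
    linear_combination (Polynomial.X ^ (n + 1) - (2 * Polynomial.X - 1) ^ n) * h
  simpa [map_ofNat] using congrArg (Polynomial.aeval x) key

theorem neg_one_zpow_sub_one {R : Type*} [CommRing R] (i : ℕ) :
    (((-1 : Rˣ) ^ ((i : ℤ) - 1) : Rˣ) : R) = (-1) ^ (i + 1) := by
  rw [zpow_sub_one, zpow_natCast, inv_neg, inv_one]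
  simp [pow_succ]

end BinomialEulerian

theorem mainTheorem7 {R : Type*} [CommRing R] (n : ℕ) (x : R) :
    (BinomialEulerian.ATilde n x 1 (-1) (-1) =
        ∑ σ ∈ BinomialEulerian.QHat n,
          x ^ BinomialEulerian.exc σ *
            (-1) ^ (BinomialEulerian.cyc σ + BinomialEulerian.fcyc σ) ∧
      ∑ σ ∈ BinomialEulerian.QHat n,
          x ^ BinomialEulerian.exc σ *
            (-1) ^ (BinomialEulerian.cyc σ + BinomialEulerian.fcyc σ) =
        (-1) ^ n * ∑ j ∈ Finset.range (n + 1), x ^ j) ∧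
    (BinomialEulerian.ATilde n x 1 (-1) 1 =
        ∑ σ ∈ BinomialEulerian.QHat n,
          x ^ BinomialEulerian.exc σ * (-1) ^ BinomialEulerian.cyc σ ∧
      ∑ σ ∈ BinomialEulerian.QHat n,
          x ^ BinomialEulerian.exc σ * (-1) ^ BinomialEulerian.cyc σ =
        ∑ k ∈ Finset.range (n + 1), x ^ (n - k) *
          ∑ i ∈ Finset.Icc k n,
            (((-1 : Rˣ) ^ ((i : ℤ) - 1) : Rˣ) : R) * 2 ^ (n - i) * (n.choose i : R)) := by
  open BinomialEulerian in
  have hA : ∑ σ ∈ QHat n, x ^ exc σ * (-1) ^ (cyc σ + fcyc σ) =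
      ∑ σ ∈ QHat n, x ^ exc σ * (-1) ^ cyc σ * (-1) ^ fcyc σ :=
    Finset.sum_congr rfl fun σ _ => by rw [pow_add, mul_assoc]
  open BinomialEulerian in
  have hB : ∑ σ ∈ QHat n, x ^ exc σ * (-1) ^ cyc σ =
      ∑ σ ∈ QHat n, x ^ exc σ * (-1) ^ cyc σ * 1 ^ fcyc σ :=
    Finset.sum_congr rfl fun σ _ => by rw [one_pow, mul_one]
  refine ⟨⟨?_, ?_⟩, ?_, ?_⟩
  · rw [hA]
    simp [BinomialEulerian.ATilde]
  · rw [hA, BinomialEulerian.sum_QHat_eq, neg_one_mul, neg_neg,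
      BinomialEulerian.sum_choose_mul_pow_eq_geom_sum]
    ring
  · simp [BinomialEulerian.ATilde]
  · simp only [BinomialEulerian.neg_one_zpow_sub_one]
    rw [hB, BinomialEulerian.sum_QHat_eq, mul_one, one_mul,
      BinomialEulerian.sum_choose_mul_neg_pow_eq]
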